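/- A \emph{tanglegram} $(T,S,\phi)$ of size $n$ consists of two rooted binary trees $T,S$, each with $n$ leaves, and a bijection $\phi$ from the leaves of $T$ (indexed by $[n]$) to the leaves of $S$. A \emph{layout} is a pair $(X,Y)$, where $X$ and $Y$ list the leaves of $T$ and of $S$ from top to bottom in planar drawings of $T$ and $S$ with their leaves on two parallel vertical lines and the trees on opposite outer sides of them. A \emph{crossing} of $(X,Y)$ is a pair of leaves $t,t'$ of $T$ such that $t$ precedes $t'$ in $X$ while $\phi(t')$ precedes $\phi(t)$ in $Y$. The \emph{crossing number} $\mathrm{crt}(T,S,\phi)$ is the minimum number of crossings over all layouts; a tanglegram is \emph{planar} if its crossing number is $0$, and a layout is \emph{planar} if it has no crossings. For a nonempty $I\subseteq[n]$, the \emph{induced subtanglegram} $(T_I,S_{\phi(I)},\phi|_I)$ has as its trees the minimal subtrees of $T$ and $S$ containing the leaves in $I$ and in $\phi(I)$, with all internal vertices having only one child suppressed; a layout of $(T,S,\phi)$ restricts to a layout of it by passing to sublists. If $I=[n]\setminus\{i\}$ is nonempty and $(T_I,S_{\phi(I)},\phi|_I)$ is planar, let $\mathrm{crt}_{ei}((T,S,\phi),i)$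 be the minimum number of crossings over all layouts of $(T,S,\phi)$ that restrict to a planar layout of $(T_I,S_{\phi(I)},\phi|_I)$. If there is at least one such $i$, let $\mathrm{crt}_{ei}(T,S,\phi)$ be the minimum of $\mathrm{crt}_{ei}((T,S,\phi),i)$ over all such $i$. \textbf{Corollary.} For every $k\in\mathbb{N}$ (including $k=0$) there exists a tanglegram $(T,S,\phi)$ for which $\mathrm{crt}_{ei}(T,S,\phi)$ is defined and $$\mathrm{crt}_{ei}(T,S,\phi)-\mathrm{crt}(T,S,\phi)=k.$$ -/

import Mathlib

/-- Rooted binary trees with leaves labelled in `α`: every vertex has zero or two children.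
The order in which the two children are written carries no meaning for the notions below:
a drawing of the tree may put either child on top, see `IsLeafOrder`. -/
inductive BinTree (α : Type*) : Type _ where
  | leaf : α → BinTree α
  | node : BinTree α → BinTree α → BinTree α

namespace BinTree

variable {α : Type*}

/-- The list of leaf labels. -/
def leaves : BinTree α → List α
  | leaf a => [a]
  | node l r => l.leaves ++ r.leaves

/-- `T.IsLeafOrder X`: in some plane embedding of `T` with its leaves on a vertical line,
the leaves read from top to bottom form the list `X`. At every internal vertex, either child
may be drawn on top. -/
inductive IsLeafOrder : BinTree α → List α → Prop where
  | leaf (a : α) : IsLeafOrder (.leaf a) [a]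
  | node_left {l r : BinTree α} {X Y : List α} :
      IsLeafOrder l X → IsLeafOrder r Y → IsLeafOrder (.node l r) (X ++ Y)
  | node_right {l r : BinTree α} {X Y : List α} :
      IsLeafOrder l X → IsLeafOrder r Y → IsLeafOrder (.node l r) (Y ++ X)

end BinTree

/-- The sublist of `X` formed by its entries in `I`. -/
def List.restrictTo {α : Type*} [DecidableEq α] (I : Finset α) (X : List α) : List I :=
  X.filterMap fun a => if h : a ∈ I then some ⟨a, h⟩ else none

theorem List.mem_restrictTo {α : Type*} [DecidableEq α] {I : Finset α} {X : List α} {a : I} :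
    a ∈ X.restrictTo I ↔ (a : α) ∈ X := by
  simp only [List.restrictTo, List.mem_filterMap]
  constructor
  · rintro ⟨b, hb, h⟩
    split_ifs at h with hI
    simp only [Option.some.injEq] at h
    subst h
    exact hb
  · intro h
    exact ⟨a, h, by simp⟩

theorem List.Nodup.restrictTo {α : Type*} [DecidableEq α] {I : Finset α} {X : List α}
    (h : X.Nodup) : (X.restrictTo I).Nodup := by
  refine h.filterMap ?_
  intro a b c ha hb
  simp only [Option.mem_def] at ha hb
  split_ifs at ha with h1
  split_ifs at hb with h2
  simp only [Option.some.injEq] at ha hb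
  rw [← hb] at ha
  exact congrArg Subtype.val ha

namespace BinTree

variable {α : Type*} [DecidableEq α]

/-- The subtree spanned by the leaves with label in `I`, internal vertices with only one
remaining child being suppressed; it is `none` if no leaf has its label in `I`. -/
def induce? (I : Finset α) : BinTree α → Option (BinTree I)
  | leaf a => if h : a ∈ I then some (leaf ⟨a, h⟩) else none
  | node l r =>
    match l.induce? I, r.induce? I with
    | some l', some r' => some (node l' r')
    | some l', none => some l'
    | none, some r' => some r'
    | none, none => none

theorem leaves_induce? (I : Finset α) (T : BinTree α) :
    ((T.induce? I).elim [] leaves) = T.leaves.restrictTo I := by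
  induction T with
  | leaf a =>
    by_cases h : a ∈ I <;> simp [induce?, leaves, List.restrictTo, h]
  | node l r ihl ihr =>
    have happ : (node l r).leaves.restrictTo I
        = l.leaves.restrictTo I ++ r.leaves.restrictTo I := by
      simp [leaves, List.restrictTo]
    rw [happ, ← ihl, ← ihr]
    simp only [induce?]
    cases l.induce? I <;> cases r.induce? I <;> simp [leaves]

theorem isSome_induce? {I : Finset α} (hI : I.Nonempty) {T : BinTree α}
    (hT : ∀ a, a ∈ T.leaves) : (T.induce? I).isSome := by
  obtain ⟨a, ha⟩ := hI
  have hmem : (⟨a, ha⟩ : I) ∈ T.leaves.restrictTo I := List.mem_restrictTo.2 (hT a)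
  rw [← leaves_induce?] at hmem
  cases h : T.induce? I with
  | none => simp [h] at hmem
  | some t => rfl

/-- The rooted binary subtree of `T` induced by a nonempty set `I` of leaves. -/
def induce (T : BinTree α) (hT : ∀ a, a ∈ T.leaves) (I : Finset α) (hI : I.Nonempty) :
    BinTree I :=
  (T.induce? I).get (isSome_induce? hI hT)

theorem leaves_induce (T : BinTree α) (hT : ∀ a, a ∈ T.leaves) (I : Finset α)
    (hI : I.Nonempty) : (T.induce hT I hI).leaves = T.leaves.restrictTo I := by
  rw [← leaves_induce?]
  obtain ⟨t, ht⟩ := Option.isSome_iff_exists.1 (isSome_induce? hI hT)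
  simp [induce, ht]

end BinTree

/-- A tanglegram `(T, S, φ)`: two rooted binary trees whose leaves are indexed bijectively by
`α` and by `β`, and a bijection `φ` between their leaves. -/
structure Tanglegram (α β : Type*) where
  T : BinTree α
  S : BinTree β
  φ : α ≃ β
  nodup_T : T.leaves.Nodup
  mem_T : ∀ a, a ∈ T.leaves
  nodup_S : S.leaves.Nodup
  mem_S : ∀ b, b ∈ S.leaves

namespace Tanglegram

variable {α β : Type*}

/-- The set of leaves of the second tree that are matched with the leaves in `I`. -/
def matched (G : Tanglegram α β) (I : Finset α) : Finset β := I.map G.φ.toEmbedding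

theorem matched_nonempty (G : Tanglegram α β) {I : Finset α} (hI : I.Nonempty) :
    (G.matched I).Nonempty :=
  hI.map

variable [Fintype α] [DecidableEq α] [DecidableEq β]

/-- `(X, Y)` is a layout of the tanglegram, given by the orders of the leaves of the two trees
from top to bottom. -/
def IsLayout (G : Tanglegram α β) (X : List α) (Y : List β) : Prop :=
  G.T.IsLeafOrder X ∧ G.S.IsLeafOrder Y

/-- The number of crossings of a layout `(X, Y)`: the number of pairs of between-tree edges,
at `a` and at `b`, with `a` above `b` in `X` and the partner of `a` below the partner of `b`
in `Y`. -/
def crossings (G : Tanglegram α β) (X : List α) (Y : List β) : ℕ :=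
  (Finset.univ.filter fun p : α × α =>
    X.idxOf p.1 < X.idxOf p.2 ∧ Y.idxOf (G.φ p.2) < Y.idxOf (G.φ p.1)).card

/-- The crossing number: the minimum number of crossings over all layouts. -/
noncomputable def crt (G : Tanglegram α β) : ℕ :=
  sInf {c | ∃ X Y, G.IsLayout X Y ∧ G.crossings X Y = c}

/-- A tanglegram is planar if its crossing number is zero. -/
def IsPlanar (G : Tanglegram α β) : Prop := G.crt = 0

/-- A planar layout is a layout without crossings. -/
def IsPlanarLayout (G : Tanglegram α β) (X : List α) (Y : List β) : Prop :=
  G.IsLayout X Y ∧ G.crossings X Y = 0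

/-- The subtanglegram `(T_I, S_{φ(I)}, φ|_I)` induced by a nonempty set `I`. -/
def sub (G : Tanglegram α β) (I : Finset α) (hI : I.Nonempty) :
    Tanglegram I (G.matched I) where
  T := G.T.induce G.mem_T I hI
  S := G.S.induce G.mem_S (G.matched I) (G.matched_nonempty hI)
  φ := G.φ.subtypeEquiv fun a => by simp [matched]
  nodup_T := by
    rw [BinTree.leaves_induce]
    exact G.nodup_T.restrictTo
  mem_T a := by
    rw [BinTree.leaves_induce]
    exact List.mem_restrictTo.2 (G.mem_T a)
  nodup_S := by
    rw [BinTree.leaves_induce]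
    exact G.nodup_S.restrictTo
  mem_S b := by
    rw [BinTree.leaves_induce]
    exact List.mem_restrictTo.2 (G.mem_S b)

/-- Deleting the between-tree edge at the leaf `i` leaves a planar (nonempty) subtanglegram. -/
def PlanarWithout (G : Tanglegram α β) (i : α) : Prop :=
  ∃ hI : (Finset.univ.erase i).Nonempty, (G.sub (Finset.univ.erase i) hI).IsPlanar

/-- The layout `(X, Y)` is feasible for the single edge insertion problem at `i`: it is a layout
of the tanglegram that restricts to a planar layout of the subtanglegram without `i`. -/
def IsInsertionLayout (G : Tanglegram α β) (i : α) (X : List α) (Y : List β) : Prop :=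
  G.IsLayout X Y ∧ ∃ hI : (Finset.univ.erase i).Nonempty,
    (G.sub (Finset.univ.erase i) hI).IsPlanarLayout
      (X.restrictTo (Finset.univ.erase i)) (Y.restrictTo (G.matched (Finset.univ.erase i)))

/-- The minimum number of crossings in the single edge insertion problem at `i`
(meaningful when `G.PlanarWithout i`). -/
noncomputable def crteiAt (G : Tanglegram α β) (i : α) : ℕ :=
  sInf {c | ∃ X Y, G.IsInsertionLayout i X Y ∧ G.crossings X Y = c}

/-- The minimum of `G.crteiAt i` over all `i` for which the single edge insertion problem is
defined (meaningful when there is such an `i`). -/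
noncomputable def crtei (G : Tanglegram α β) : ℕ :=
  sInf {c | ∃ i, G.PlanarWithout i ∧ G.crteiAt i = c}

end Tanglegram

/-! Start from a five-leaf tanglegram with identity matching (`patternT`, `patternS`) and replace
leaf `b` by a block of `weight m b` leaves, the weights being 1, m, 1, m, 2 and each block carrying
the same tree on both sides. By `exists_blowup`, every layout of the blow-up crosses leaves of
different blocks exactly as some layout of the pattern does, and every pattern layout is realised
with no crossing inside a block. So minimal crossing counts are minimal sums of weight products over
the inversions of a pattern layout.

Take m ≥ 4. Without constraint, moving block 4 across leaves 0 and 2 costs 2 + 2, and nothing is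
cheaper: the crossing number is 4. Edge insertion is possible only at the single leaf labelled 2: a
block of size at least 2 survives the loss of one leaf, and the pattern without 0 is not planar.
Without 2, the planar order is 0, 1, 3, 4 up to reversal. There 2 is next to 3 in one tree and next
to 0 in the other, so its edge must cross all of block 1, and m crossings are forced and attained.
The gap is m - 4, and m = k + 4 gives the result. -/

namespace List

/-! ### Relative positions in lists and their restrictions -/

variable {α : Type*} [DecidableEq α]

theorem Pairwise.rel_of_idxOf_lt {R : α → α → Prop} {X : List α} (h : X.Pairwise R) {u v : α}
    (hv : v ∈ X) (huv : X.idxOf u < X.idxOf v) : R u v := by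
  have hv' := List.idxOf_lt_length_iff.2 hv
  have := List.pairwise_iff_getElem.1 h _ _ (huv.trans hv') hv' huv
  simpa using this

theorem Pairwise.idxOf_lt_iff {g : α → ℕ} {X : List α} (h : X.Pairwise fun u v => g u < g v)
    {u v : α} (hu : u ∈ X) (hv : v ∈ X) : X.idxOf u < X.idxOf v ↔ g u < g v := by
  refine ⟨h.rel_of_idxOf_lt hv, fun hg => ?_⟩
  by_contra hlt
  rcases (not_lt.1 hlt).lt_or_eq with h' | h'
  · exact lt_asymm hg (h.rel_of_idxOf_lt hu h')
  · exact hg.ne (congrArg g ((List.idxOf_inj hv).1 h').symm)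

theorem Nodup.pairwise_idxOf_lt {X : List α} (h : X.Nodup) :
    X.Pairwise fun u v => X.idxOf u < X.idxOf v := by
  rw [List.pairwise_iff_getElem]
  intro i j hi hj hij
  rwa [h.idxOf_getElem, h.idxOf_getElem]

theorem Nodup.pairwise_restrictTo {X : List α} (h : X.Nodup) (I : Finset α) :
    (X.restrictTo I).Pairwise fun u v : I => X.idxOf (u : α) < X.idxOf (v : α) := by
  rw [List.restrictTo, List.pairwise_filterMap]
  refine h.pairwise_idxOf_lt.imp fun {a b} hab c hc d hd => ?_
  split_ifs at hc hd
  simp only [Option.some.injEq] at hc hd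
  subst hc hd
  exact hab

theorem restrictTo_append (I : Finset α) (X Y : List α) :
    (X ++ Y).restrictTo I = X.restrictTo I ++ Y.restrictTo I := by
  simp [List.restrictTo]

end List

/-! ### Leaf orders under substitution and under restriction -/

namespace BinTree

variable {α β : Type*}

theorem isLeafOrder_leaves (t : BinTree α) : t.IsLeafOrder t.leaves := by
  induction t with
  | leaf a => exact .leaf a
  | node l r hl hr => exact .node_left hl hr

theorem IsLeafOrder.perm {t : BinTree α} {X : List α} (h : t.IsLeafOrder X) :
    X.Perm t.leaves := by
  induction h with
  | leaf a => exact .refl _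
  | node_left _ _ hl hr => exact hl.append hr
  | node_right _ _ hl hr => exact List.perm_append_comm.trans (hl.append hr)

theorem exists_leaves_eq {l : List α} (hl : l ≠ []) : ∃ t : BinTree α, t.leaves = l := by
  induction l with
  | nil => exact absurd rfl hl
  | cons a l ih =>
    rcases eq_or_ne l [] with rfl | h
    · exact ⟨.leaf a, rfl⟩
    · obtain ⟨t, ht⟩ := ih h
      exact ⟨.node (.leaf a) t, by simp [leaves, ht]⟩

/-- All the leaf orders of a tree. -/
def orders : BinTree α → List (List α)
  | leaf a => [[a]]
  | node l r => l.orders.flatMap fun X => r.orders.flatMap fun Y => [X ++ Y, Y ++ X]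

theorem IsLeafOrder.mem_orders {t : BinTree α} {X : List α} (h : t.IsLeafOrder X) :
    X ∈ t.orders := by
  induction h with
  | leaf a => simp [orders]
  | @node_left l r X Y _ _ hl hr =>
    simp only [orders, List.mem_flatMap]
    exact ⟨X, hl, Y, hr, by simp⟩
  | @node_right l r X Y _ _ hl hr =>
    simp only [orders, List.mem_flatMap]
    exact ⟨X, hl, Y, hr, by simp⟩

theorem isLeafOrder_of_mem_orders {t : BinTree α} {X : List α} (h : X ∈ t.orders) :
    t.IsLeafOrder X := by
  induction t generalizing X with
  | leaf a =>
    simp only [orders, List.mem_singleton] at h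
    exact h ▸ .leaf a
  | node l r hl hr =>
    simp only [orders, List.mem_flatMap, List.mem_cons, List.not_mem_nil, or_false] at h
    obtain ⟨Y, hY, Z, hZ, rfl | rfl⟩ := h
    · exact .node_left (hl hY) (hr hZ)
    · exact .node_right (hl hY) (hr hZ)

/-- The tree obtained by replacing every leaf `b` by the tree `blk b`. -/
def subst (blk : β → BinTree α) : BinTree β → BinTree α
  | leaf b => blk b
  | node l r => node (l.subst blk) (r.subst blk)

theorem leaves_subst (blk : β → BinTree α) (t : BinTree β) :
    (t.subst blk).leaves = t.leaves.flatMap fun b => (blk b).leaves := by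
  induction t with
  | leaf b => simp [subst, leaves]
  | node l r hl hr => simp [subst, leaves, hl, hr]

theorem IsLeafOrder.subst {t : BinTree β} {A : List β} (h : t.IsLeafOrder A)
    (blk : β → BinTree α) :
    (t.subst blk).IsLeafOrder (A.flatMap fun b => (blk b).leaves) := by
  induction h with
  | leaf b => simpa [BinTree.subst] using isLeafOrder_leaves (blk b)
  | node_left _ _ hl hr => simpa [BinTree.subst] using hl.node_left hr
  | node_right _ _ hl hr => simpa [BinTree.subst] using hl.node_right hr

/-- Each block is a subtree, hence contiguous in any drawing; contracting the blocks leaves a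
drawing of `t`. The membership clause feeds the induction: it orders labels lying under different
children. -/
theorem exists_isLeafOrder_of_subst {blk : β → BinTree α} {f : α → β}
    (hf : ∀ b, ∀ a ∈ (blk b).leaves, f a = b) {t : BinTree β} {X : List α}
    (h : (t.subst blk).IsLeafOrder X) :
    ∃ A, t.IsLeafOrder A ∧ (∀ u ∈ X, f u ∈ A) ∧
      X.Pairwise fun u v => f u = f v ∨ [f u, f v].Sublist A := by
  induction t generalizing X with
  | leaf b =>
    have hX : ∀ u ∈ X, f u = b := fun u hu => hf b u ((IsLeafOrder.perm h).mem_iff.1 hu)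
    refine ⟨[b], .leaf b, fun u hu => by simp [hX u hu], ?_⟩
    exact List.pairwise_of_forall_mem_list fun u hu v hv => .inl ((hX u hu).trans (hX v hv).symm)
  | node l r hl hr =>
    have key : ∀ {A B : List β} {Y Z : List α}, (∀ u ∈ Y, f u ∈ A) → (∀ u ∈ Z, f u ∈ B) →
        (Y.Pairwise fun u v => f u = f v ∨ [f u, f v].Sublist A) →
        (Z.Pairwise fun u v => f u = f v ∨ [f u, f v].Sublist B) →
        (∀ u ∈ Y ++ Z, f u ∈ A ++ B) ∧
          (Y ++ Z).Pairwise fun u v => f u = f v ∨ [f u, f v].Sublist (A ++ B) := by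
      intro A B Y Z hA hB hY hZ
      refine ⟨fun u hu => ?_, List.pairwise_append.2 ⟨?_, ?_, ?_⟩⟩
      · rcases List.mem_append.1 hu with hu | hu
        · exact List.mem_append_left _ (hA u hu)
        · exact List.mem_append_right _ (hB u hu)
      · exact hY.imp fun h => h.imp id fun h => h.trans (List.sublist_append_left A B)
      · exact hZ.imp fun h => h.imp id fun h => h.trans (List.sublist_append_right A B)
      · intro u hu v hv
        exact .inr ((List.singleton_sublist.2 (hA u hu)).append
          (List.singleton_sublist.2 (hB v hv)))
    cases h with
    | node_left h1 h2 =>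
      obtain ⟨A, hA, hA', hA''⟩ := hl h1
      obtain ⟨B, hB, hB', hB''⟩ := hr h2
      exact ⟨A ++ B, hA.node_left hB, key hA' hB' hA'' hB''⟩
    | node_right h1 h2 =>
      obtain ⟨A, hA, hA', hA''⟩ := hl h1
      obtain ⟨B, hB, hB', hB''⟩ := hr h2
      exact ⟨B ++ A, hA.node_right hB, key hB' hA' hB'' hA''⟩

variable [DecidableEq α]

theorem IsLeafOrder.restrictTo {t : BinTree α} {X : List α} (h : t.IsLeafOrder X)
    (I : Finset α) :
    (∀ t', t.induce? I = some t' → t'.IsLeafOrder (X.restrictTo I)) ∧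
      (t.induce? I = none → X.restrictTo I = []) := by
  induction h with
  | leaf a =>
    by_cases ha : a ∈ I
    · simpa [induce?, ha, List.restrictTo] using IsLeafOrder.leaf (⟨a, ha⟩ : I)
    · simp [induce?, ha, List.restrictTo]
  | @node_left l r X Y _ _ hl hr =>
    rw [List.restrictTo_append]
    simp only [induce?]
    cases hl' : l.induce? I <;> cases hr' : r.induce? I <;> simp_all
    exact hl.node_left hr
  | @node_right l r X Y _ _ hl hr =>
    rw [List.restrictTo_append]
    simp only [induce?]
    cases hl' : l.induce? I <;> cases hr' : r.induce? I <;> simp_all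
    exact hl.node_right hr

/-- Drawings of the induced tree extend to the whole tree: subtrees with no label in `I` can be
drawn arbitrarily, and surviving branchings keep their orientation. -/
theorem exists_restrictTo_eq {I : Finset α} {t : BinTree α} {t' : BinTree I}
    (h : t.induce? I = some t') {Z : List I} (hZ : t'.IsLeafOrder Z) :
    ∃ X, t.IsLeafOrder X ∧ X.restrictTo I = Z := by
  induction t generalizing t' Z with
  | leaf a =>
    by_cases ha : a ∈ I
    · simp only [induce?, ha, dite_true, Option.some.injEq] at h
      subst h
      cases hZ
      exact ⟨[a], .leaf a, by simp [List.restrictTo, ha]⟩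
    · simp [induce?, ha] at h
  | node l r hl hr =>
    simp only [induce?] at h
    cases hl' : l.induce? I <;> cases hr' : r.induce? I <;> simp only [hl', hr'] at h
    · simp at h
    · simp only [Option.some.injEq] at h
      subst h
      obtain ⟨Y, hY, rfl⟩ := hr hr' hZ
      refine ⟨l.leaves ++ Y, (isLeafOrder_leaves l).node_left hY, ?_⟩
      rw [List.restrictTo_append, ((isLeafOrder_leaves l).restrictTo I).2 hl', List.nil_append]
    · simp only [Option.some.injEq] at h
      subst h
      obtain ⟨Y, hY, rfl⟩ := hl hl' hZ
      refine ⟨Y ++ r.leaves, hY.node_left (isLeafOrder_leaves r), ?_⟩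
      rw [List.restrictTo_append, ((isLeafOrder_leaves r).restrictTo I).2 hr', List.append_nil]
    · simp only [Option.some.injEq] at h
      subst h
      cases hZ with
      | node_left h1 h2 =>
        obtain ⟨X, hX, rfl⟩ := hl hl' h1
        obtain ⟨Y, hY, rfl⟩ := hr hr' h2
        exact ⟨X ++ Y, hX.node_left hY, List.restrictTo_append _ _ _⟩
      | node_right h1 h2 =>
        obtain ⟨X, hX, rfl⟩ := hl hl' h1
        obtain ⟨Y, hY, rfl⟩ := hr hr' h2
        exact ⟨Y ++ X, hX.node_right hY, List.restrictTo_append _ _ _⟩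

theorem induce?_eq_some_induce (t : BinTree α) (ht : ∀ a, a ∈ t.leaves) (I : Finset α)
    (hI : I.Nonempty) : t.induce? I = some (t.induce ht I hI) := by
  simp [induce]

end BinTree

/-! ### Edge insertion expressed by crossings in the full tanglegram -/

namespace Tanglegram

variable {α β : Type*}

theorem isLayout_leaves (G : Tanglegram α β) : G.IsLayout G.T.leaves G.S.leaves :=
  ⟨G.T.isLeafOrder_leaves, G.S.isLeafOrder_leaves⟩

variable [DecidableEq α] [DecidableEq β]

theorem isLayout_sub_restrictTo {G : Tanglegram α β} {X : List α} {Y : List β}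
    (h : G.IsLayout X Y) (I : Finset α) (hI : I.Nonempty) :
    (G.sub I hI).IsLayout (X.restrictTo I) (Y.restrictTo (G.matched I)) :=
  ⟨(h.1.restrictTo I).1 _ (G.T.induce?_eq_some_induce G.mem_T I hI),
    (h.2.restrictTo _).1 _ (G.S.induce?_eq_some_induce G.mem_S _ (G.matched_nonempty hI))⟩

/-- The between-tree edges at `u` and at `v` cross in `(X, Y)`, with `u` above `v` in `X`. -/
def Crosses (G : Tanglegram α β) (X : List α) (Y : List β) (u v : α) : Prop :=
  X.idxOf u < X.idxOf v ∧ Y.idxOf (G.φ v) < Y.idxOf (G.φ u)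

theorem crossings_eq_zero_iff [Fintype α] (G : Tanglegram α β) (X : List α) (Y : List β) :
    G.crossings X Y = 0 ↔ ∀ u v, ¬ G.Crosses X Y u v := by
  simp [crossings, Crosses, Finset.filter_eq_empty_iff]

/-- Restriction preserves relative order, so induced subtanglegrams can be avoided from here on. -/
theorem crossings_sub_restrictTo_eq_zero_iff {G : Tanglegram α β} {X : List α} {Y : List β}
    (h : G.IsLayout X Y) (I : Finset α) (hI : I.Nonempty) :
    (G.sub I hI).crossings (X.restrictTo I) (Y.restrictTo (G.matched I)) = 0 ↔
      ∀ u ∈ I, ∀ v ∈ I, ¬ G.Crosses X Y u v := by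
  have hX : ∀ a, a ∈ X := fun a => h.1.perm.mem_iff.2 (G.mem_T a)
  have hY : ∀ b, b ∈ Y := fun b => h.2.perm.mem_iff.2 (G.mem_S b)
  have hX' : X.Nodup := h.1.perm.nodup_iff.2 G.nodup_T
  have hY' : Y.Nodup := h.2.perm.nodup_iff.2 G.nodup_S
  have hX'' := fun u v : I => (hX'.pairwise_restrictTo I).idxOf_lt_iff
    (g := fun w : I => X.idxOf (w : α)) (u := u) (v := v)
    (List.mem_restrictTo.2 (hX _)) (List.mem_restrictTo.2 (hX _))
  have hY'' := fun u v : G.matched I => (hY'.pairwise_restrictTo (G.matched I)).idxOf_lt_iff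
    (g := fun w : G.matched I => Y.idxOf (w : β)) (u := u) (v := v)
    (List.mem_restrictTo.2 (hY _)) (List.mem_restrictTo.2 (hY _))
  simp only [crossings_eq_zero_iff, Crosses, hX'', hY'', Subtype.forall]
  rfl

variable [Fintype α]

theorem crt_le {G : Tanglegram α β} {X : List α} {Y : List β} (h : G.IsLayout X Y) :
    G.crt ≤ G.crossings X Y :=
  Nat.sInf_le ⟨X, Y, h, rfl⟩

theorem exists_crossings_eq_crt (G : Tanglegram α β) :
    ∃ X Y, G.IsLayout X Y ∧ G.crossings X Y = G.crt :=
  Nat.sInf_mem (s := {c | ∃ X Y, G.IsLayout X Y ∧ G.crossings X Y = c})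
    ⟨_, _, _, G.isLayout_leaves, rfl⟩

theorem isPlanar_iff (G : Tanglegram α β) : G.IsPlanar ↔ ∃ X Y, G.IsPlanarLayout X Y := by
  constructor
  · intro h
    obtain ⟨X, Y, hXY, hc⟩ := G.exists_crossings_eq_crt
    exact ⟨X, Y, hXY, hc.trans h⟩
  · rintro ⟨X, Y, hXY, hc⟩
    exact Nat.le_zero.1 (hc ▸ crt_le hXY)

theorem isInsertionLayout_iff {G : Tanglegram α β} {i : α} {X : List α} {Y : List β} :
    G.IsInsertionLayout i X Y ↔ G.IsLayout X Y ∧ (Finset.univ.erase i).Nonempty ∧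
      ∀ u v, u ≠ i → v ≠ i → ¬ G.Crosses X Y u v := by
  refine and_congr_right fun h => ?_
  rw [← exists_prop]
  refine exists_congr fun hI => ?_
  rw [IsPlanarLayout, and_iff_right (isLayout_sub_restrictTo h _ hI),
    crossings_sub_restrictTo_eq_zero_iff h]
  simp only [Finset.mem_erase, Finset.mem_univ, and_true]
  grind

/-- A planar layout of the subtanglegram lifts on each side by `BinTree.exists_restrictTo_eq`. In
particular the infimum defining `crteiAt` is over a nonempty set. -/
theorem planarWithout_iff {G : Tanglegram α β} {i : α} :
    G.PlanarWithout i ↔ ∃ X Y, G.IsInsertionLayout i X Y := by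
  constructor
  · rintro ⟨hI, h⟩
    obtain ⟨Z, W, hZW⟩ := (isPlanar_iff _).1 h
    obtain ⟨X, hX, rfl⟩ :=
      BinTree.exists_restrictTo_eq (G.T.induce?_eq_some_induce G.mem_T _ hI) hZW.1.1
    obtain ⟨Y, hY, rfl⟩ :=
      BinTree.exists_restrictTo_eq
        (G.S.induce?_eq_some_induce G.mem_S _ (G.matched_nonempty hI)) hZW.1.2
    exact ⟨X, Y, ⟨hX, hY⟩, hI, hZW⟩
  · rintro ⟨X, Y, -, hI, h⟩
    exact ⟨hI, (isPlanar_iff _).2 ⟨_, _, h⟩⟩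

theorem exists_crossings_eq_crteiAt {G : Tanglegram α β} {i : α} (h : G.PlanarWithout i) :
    ∃ X Y, G.IsInsertionLayout i X Y ∧ G.crossings X Y = G.crteiAt i := by
  obtain ⟨X, Y, hXY⟩ := planarWithout_iff.1 h
  exact Nat.sInf_mem (s := {c | ∃ X Y, G.IsInsertionLayout i X Y ∧ G.crossings X Y = c})
    ⟨_, X, Y, hXY, rfl⟩

theorem crteiAt_le {G : Tanglegram α β} {i : α} {X : List α} {Y : List β}
    (h : G.IsInsertionLayout i X Y) : G.crteiAt i ≤ G.crossings X Y :=
  Nat.sInf_le ⟨X, Y, h, rfl⟩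

theorem crtei_eq_of_unique {G : Tanglegram α β} {i : α} (h : G.PlanarWithout i)
    (huniq : ∀ j, G.PlanarWithout j → j = i) : G.crtei = G.crteiAt i := by
  have : {c | ∃ i, G.PlanarWithout i ∧ G.crteiAt i = c} = {G.crteiAt i} := by
    ext c
    simp only [Set.mem_ofPred_eq, Set.mem_singleton_iff]
    constructor
    · rintro ⟨j, hj, rfl⟩
      rw [huniq j hj]
    · rintro rfl
      exact ⟨i, h, rfl⟩
  rw [crtei, this, csInf_singleton]

end Tanglegram

/-! ### Counting crossings through block labels -/

/-- The ordered pairs of labels that are inverted between the lists `A` and `B`. -/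
def inversions {β : Type*} [Fintype β] [DecidableEq β] (A B : List β) : Finset (β × β) :=
  Finset.univ.filter fun p => A.idxOf p.1 < A.idxOf p.2 ∧ B.idxOf p.2 < B.idxOf p.1

theorem card_filter_prodMap_mem {α β : Type*} [Fintype α] [DecidableEq β] (f : α → β)
    (K : Finset (β × β)) :
    (Finset.univ.filter fun p : α × α => (f p.1, f p.2) ∈ K).card =
      ∑ q ∈ K, (Finset.univ.filter fun a => f a = q.1).card *
        (Finset.univ.filter fun a => f a = q.2).card := by
  rw [Finset.card_eq_sum_card_fiberwise (f := fun p : α × α => (f p.1, f p.2)) (t := K)]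
  · refine Finset.sum_congr rfl fun q hq => ?_
    rw [← Finset.card_product]
    congr 1
    ext p
    simp only [Finset.mem_filter, Finset.mem_univ, true_and, Finset.mem_product, Prod.ext_iff]
    constructor
    · exact fun h => h.2
    · rintro ⟨h1, h2⟩
      exact ⟨by rw [h1, h2]; exact hq, h1, h2⟩
  · intro p hp
    simpa using hp

theorem List.idxOf_lt_iff_of_pairwise_label {α β : Type*} [DecidableEq α] [DecidableEq β]
    {f : α → β} {X : List α} {A : List β} (hA : A.Nodup)
    (h : X.Pairwise fun u v => f u = f v ∨ [f u, f v].Sublist A) {u v : α}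
    (hu : u ∈ X) (hv : v ∈ X) (huv : f u ≠ f v) :
    X.idxOf u < X.idxOf v ↔ A.idxOf (f u) < A.idxOf (f v) := by
  have key : ∀ {u v : α}, v ∈ X → f u ≠ f v → X.idxOf u < X.idxOf v →
      A.idxOf (f u) < A.idxOf (f v) := by
    intro u v hv huv hlt
    have hs := (h.rel_of_idxOf_lt hv hlt).resolve_left huv
    simpa using hA.pairwise_idxOf_lt.sublist hs
  refine ⟨key hv huv, fun hlt => ?_⟩
  by_contra hn
  rcases (not_lt.1 hn).lt_or_eq with h' | h'
  · exact lt_asymm hlt (key hu huv.symm h')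
  · exact huv (congrArg f ((List.idxOf_inj hv).1 h').symm)

/-! ### Blowing up the leaves of a tanglegram -/

namespace Tanglegram

variable {α β : Type*} [Fintype α] [DecidableEq α] [Fintype β] [DecidableEq β]

/-- The tanglegram with identity matching obtained from a pair of trees with the same leaves by
replacing each leaf `b` by a common tree on the fibre of `f` over `b`. -/
theorem exists_blowup (f : α → β) (hf : f.Surjective) {T S : BinTree β}
    (hT : T.leaves.Nodup) (hT' : ∀ b, b ∈ T.leaves)
    (hS : S.leaves.Nodup) (hS' : ∀ b, b ∈ S.leaves) :
    ∃ G : Tanglegram α α,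
      (∀ X Y, G.IsLayout X Y → ∃ A B, T.IsLeafOrder A ∧ S.IsLeafOrder B ∧
        ∀ u v, f u ≠ f v → (G.Crosses X Y u v ↔ (f u, f v) ∈ inversions A B)) ∧
      ∀ A B, T.IsLeafOrder A → S.IsLeafOrder B → ∃ X Y, G.IsLayout X Y ∧
        ∀ u v, G.Crosses X Y u v ↔ (f u, f v) ∈ inversions A B := by
  -- One fixed enumeration orders every block identically on both sides.
  set ℓ := (Finset.univ : Finset α).toList with hℓ
  have hmemℓ : ∀ a, a ∈ ℓ := fun a => by simp [hℓ]
  have hnodupℓ : ℓ.Nodup := Finset.nodup_toList _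
  have hblk : ∀ b, ∃ t : BinTree α, t.leaves = ℓ.filter fun a => f a = b := by
    intro b
    obtain ⟨a, rfl⟩ := hf b
    exact BinTree.exists_leaves_eq (List.ne_nil_of_mem (a := a) (by simp [hmemℓ]))
  choose blk hblk using hblk
  have hlab : ∀ b, ∀ a ∈ (blk b).leaves, f a = b := fun b a ha => by
    simpa [hblk, hmemℓ] using ha
  have hmem : ∀ A : List β, (∀ b, b ∈ A) → ∀ a, a ∈ A.flatMap fun b => (blk b).leaves :=
    fun A hA a => List.mem_flatMap.2 ⟨f a, hA _, by simp [hblk, hmemℓ]⟩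
  have hpair : ∀ A : List β, A.Nodup → (A.flatMap fun b => (blk b).leaves).Pairwise fun u v =>
      (f u = f v ∧ ℓ.idxOf u < ℓ.idxOf v) ∨ A.idxOf (f u) < A.idxOf (f v) := by
    intro A hA
    refine List.pairwise_flatMap.2 ⟨fun b _ => ?_, hA.pairwise_idxOf_lt.imp ?_⟩
    · rw [hblk]
      refine (hnodupℓ.pairwise_idxOf_lt.filter _).imp_of_mem fun {u v} hu hv h => .inl ⟨?_, h⟩
      simp only [List.mem_filter, decide_eq_true_eq] at hu hv
      rw [hu.2, hv.2]
    · intro b c hbc u hu v hv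
      rw [hlab b u hu, hlab c v hv]
      exact .inr hbc
  have hnodup : ∀ A : List β, A.Nodup → (A.flatMap fun b => (blk b).leaves).Nodup := by
    intro A hA
    refine (hpair A hA).imp ?_
    rintro u v (h | h) rfl
    · exact lt_irrefl _ h.2
    · exact lt_irrefl _ h
  have horder : ∀ A : List β, A.Nodup → (∀ b, b ∈ A) → ∀ u v,
      (A.flatMap fun b => (blk b).leaves).idxOf u < (A.flatMap fun b => (blk b).leaves).idxOf v ↔
        (f u = f v ∧ ℓ.idxOf u < ℓ.idxOf v) ∨ A.idxOf (f u) < A.idxOf (f v) := by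
    intro A hA hA' u v
    refine ⟨(hpair A hA).rel_of_idxOf_lt (hmem A hA' v), fun h => ?_⟩
    by_contra hn
    rcases (not_lt.1 hn).lt_or_eq with h' | h'
    · have := (hpair A hA).rel_of_idxOf_lt (hmem A hA' u) h'
      rcases h with ⟨h1, h2⟩ | h <;> rcases this with ⟨h3, h4⟩ | h3
      · omega
      · rw [h1] at h3; omega
      · rw [h3] at h; omega
      · omega
    · have huv := (List.idxOf_inj (hmem A hA' v)).1 h'
      subst huv
      rcases h with ⟨-, h⟩ | h <;> omega
  let G : Tanglegram α α :=
    { T := T.subst blk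
      S := S.subst blk
      φ := Equiv.refl α
      nodup_T := by rw [BinTree.leaves_subst]; exact hnodup _ hT
      mem_T := by rw [BinTree.leaves_subst]; exact hmem _ hT'
      nodup_S := by rw [BinTree.leaves_subst]; exact hnodup _ hS
      mem_S := by rw [BinTree.leaves_subst]; exact hmem _ hS' }
  refine ⟨G, ?_, ?_⟩
  · rintro X Y ⟨hX, hY⟩
    obtain ⟨A, hA, -, hA'⟩ := BinTree.exists_isLeafOrder_of_subst hlab hX
    obtain ⟨B, hB, -, hB'⟩ := BinTree.exists_isLeafOrder_of_subst hlab hY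
    have hmX : ∀ u, u ∈ X := fun u => hX.perm.mem_iff.2 (G.mem_T u)
    have hmY : ∀ u, u ∈ Y := fun u => hY.perm.mem_iff.2 (G.mem_S u)
    refine ⟨A, B, hA, hB, fun u v huv => ?_⟩
    simp only [inversions, Finset.mem_filter, Finset.mem_univ, true_and]
    exact and_congr
      (List.idxOf_lt_iff_of_pairwise_label (hA.perm.nodup_iff.2 hT) hA' (hmX u) (hmX v) huv)
      (List.idxOf_lt_iff_of_pairwise_label (hB.perm.nodup_iff.2 hS) hB' (hmY v) (hmY u) huv.symm)
  · intro A B hA hB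
    refine ⟨_, _, ⟨hA.subst blk, hB.subst blk⟩, fun u v => ?_⟩
    have h1 := horder A (hA.perm.nodup_iff.2 hT) (fun b => hA.perm.mem_iff.2 (hT' b)) u v
    have h2 := horder B (hB.perm.nodup_iff.2 hS) (fun b => hB.perm.mem_iff.2 (hS' b)) v u
    simp only [inversions, Finset.mem_filter, Finset.mem_univ, true_and]
    -- Leaves of one block follow `ℓ` in both lists and cannot cross; the mixed cases contradict
    -- equality of labels.
    refine (and_congr h1 h2).trans ⟨?_, fun h => ⟨.inr h.1, .inr h.2⟩⟩
    rintro ⟨⟨h3, h4⟩ | h3, ⟨h5, h6⟩ | h5⟩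
    · omega
    · rw [h3] at h5; omega
    · rw [h5] at h3; omega
    · exact ⟨h3, h5⟩

/-! ### The weighted five-leaf pattern -/

/-- The first tree of the five-leaf pattern. -/
def patternT : BinTree (Fin 5) :=
  .node (.node (.leaf 0) (.node (.leaf 1) (.node (.leaf 2) (.leaf 3)))) (.leaf 4)

/-- The second tree of the five-leaf pattern. -/
def patternS : BinTree (Fin 5) :=
  .node (.node (.leaf 2) (.leaf 0)) (.node (.leaf 1) (.node (.leaf 3) (.leaf 4)))

/-- The number of leaves by which each leaf of the pattern is replaced. -/
def weight (m : ℕ) : Fin 5 → ℕ := ![1, m, 1, m, 2]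

theorem weight_mono {m m' : ℕ} (h : m ≤ m') (b : Fin 5) : weight m b ≤ weight m' b := by
  fin_cases b <;> simp [weight, h]

theorem two_le_weight {m : ℕ} (hm : 4 ≤ m) {b : Fin 5} (h0 : b ≠ 0) (h2 : b ≠ 2) :
    2 ≤ weight m b := by
  have hm' : 2 ≤ m := by omega
  fin_cases b <;> simp [weight, hm'] at h0 h2 ⊢

/-- A finite check over 16 · 16 layouts; m = 4 suffices because the weights increase with m. -/
theorem four_le_sum_inversions : ∀ A ∈ patternT.orders, ∀ B ∈ patternS.orders,
    4 ≤ ∑ p ∈ inversions A B, weight 4 p.1 * weight 4 p.2 := by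
  decide +kernel

/-- Models deleting one leaf of block `j`: only for `j = 0`, a block of size one, does the label
disappear, so only then must the inversion avoid it. -/
theorem exists_inversion_avoiding : ∀ A ∈ patternT.orders, ∀ B ∈ patternS.orders, ∀ j ≠ 2,
    ∃ p ∈ inversions A B, (p.1 = j → p.1 ≠ 0) ∧ (p.2 = j → p.2 ≠ 0) := by
  decide +kernel

/-- Inserting 2 into the planar order 0, 1, 3, 4 always makes it cross 1. Any inversion with a label
of weight m would serve the bound. -/
theorem exists_heavy_inversion : ∀ A ∈ patternT.orders, ∀ B ∈ patternS.orders,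
    (∀ p ∈ inversions A B, p.1 = 2 ∨ p.2 = 2) →
      ∃ p ∈ inversions A B, (p.1 = 1 ∨ p.1 = 3) ∨ (p.2 = 1 ∨ p.2 = 3) := by
  decide +kernel

theorem exists_tanglegram_crtei_eq (m : ℕ) (hm : 4 ≤ m) :
    ∃ (n : ℕ) (G : Tanglegram (Fin n) (Fin n)),
      (∃ i, G.PlanarWithout i) ∧ G.crtei = m ∧ G.crt = 4 := by
  have hpos : ∀ b, 0 < weight m b := by
    intro b
    fin_cases b <;> simp [weight] <;> omega
  let e := finSigmaFinEquiv (n := weight m)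
  let f : Fin (∑ b, weight m b) → Fin 5 := fun i => (e.symm i).1
  have hf : f.Surjective := fun b => ⟨e ⟨b, ⟨0, hpos b⟩⟩, by simp [f]⟩
  have hcard : ∀ b, (Finset.univ.filter fun i => f i = b).card = weight m b := by
    intro b
    rw [← Fintype.card_subtype]
    exact (Fintype.card_congr ((e.symm.subtypeEquiv fun i => Iff.rfl).trans
      (Equiv.sigmaSubtype b))).trans (Fintype.card_fin _)
  obtain ⟨G, hG, hG'⟩ := exists_blowup f hf (T := patternT) (S := patternS)
    (by decide) (by decide) (by decide) (by decide)
  have hne : ∀ {A B : List (Fin 5)} {b c : Fin 5}, (b, c) ∈ inversions A B → b ≠ c := by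
    rintro A B b c h rfl
    simp [inversions] at h
  -- An arbitrary layout may also have crossings inside blocks, so this is only a lower bound; the
  -- matching upper bound needs control of all pairs.
  have hlower : ∀ {X Y A B}, (∀ u v, f u ≠ f v →
      (G.Crosses X Y u v ↔ (f u, f v) ∈ inversions A B)) →
      ∑ p ∈ inversions A B, weight m p.1 * weight m p.2 ≤ G.crossings X Y := by
    intro X Y A B h
    simp only [← hcard]
    rw [← card_filter_prodMap_mem]
    refine Finset.card_le_card fun p hp => ?_
    simp only [Finset.mem_filter, Finset.mem_univ, true_and] at hp ⊢
    exact (h _ _ (hne hp)).2 hp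
  have hupper : ∀ {X Y A B}, (∀ u v, G.Crosses X Y u v ↔ (f u, f v) ∈ inversions A B) →
      G.crossings X Y ≤ ∑ p ∈ inversions A B, weight m p.1 * weight m p.2 := by
    intro X Y A B h
    simp only [← hcard]
    rw [← card_filter_prodMap_mem]
    refine Finset.card_le_card fun p hp => ?_
    simp only [Finset.mem_filter, Finset.mem_univ, true_and] at hp ⊢
    exact (h _ _).1 hp
  have huniq2 : ∀ i j, f i = 2 → f j = 2 → i = j := by
    intro i j hi hj
    have h1 : (Finset.univ.filter fun i => f i = 2).card ≤ 1 := (hcard 2).le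
    exact Finset.card_le_one.1 h1 i (by simp [hi]) j (by simp [hj])
  obtain ⟨x, hx⟩ := hf 2
  have hcrt : G.crt = 4 := by
    apply le_antisymm
    · obtain ⟨X, Y, hXY, h⟩ := hG' [4, 0, 2, 3, 1] [0, 2, 4, 3, 1]
        (BinTree.isLeafOrder_of_mem_orders (by decide))
        (BinTree.isLeafOrder_of_mem_orders (by decide))
      refine (crt_le hXY).trans ((hupper h).trans ?_)
      rw [show inversions ([4, 0, 2, 3, 1] : List (Fin 5)) [0, 2, 4, 3, 1] = {(4, 0), (4, 2)} by
        decide +kernel]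
      simp [weight]
    · obtain ⟨X, Y, hXY, hc⟩ := G.exists_crossings_eq_crt
      obtain ⟨A, B, hA, hB, h⟩ := hG X Y hXY
      rw [← hc]
      refine (four_le_sum_inversions A hA.mem_orders B hB.mem_orders).trans
        (le_trans ?_ (hlower h))
      exact Finset.sum_le_sum fun p _ => Nat.mul_le_mul (weight_mono hm _) (weight_mono hm _)
  -- The optimal insertion layout: leaf 2 crosses block 1 and nothing else.
  obtain ⟨X₀, Y₀, hXY₀, h₀⟩ := hG' [0, 1, 2, 3, 4] [0, 2, 1, 3, 4]
    (BinTree.isLeafOrder_of_mem_orders (by decide))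
    (BinTree.isLeafOrder_of_mem_orders (by decide))
  have hinv : inversions ([0, 1, 2, 3, 4] : List (Fin 5)) [0, 2, 1, 3, 4] = {(1, 2)} := by
    decide +kernel
  have hins : G.IsInsertionLayout x X₀ Y₀ := by
    refine isInsertionLayout_iff.2 ⟨hXY₀, ?_, fun u v _ hv hcr => ?_⟩
    · obtain ⟨a, ha⟩ := hf 0
      refine ⟨a, Finset.mem_erase.2 ⟨?_, Finset.mem_univ _⟩⟩
      rintro rfl
      rw [hx] at ha
      exact absurd ha (by decide)
    · rw [h₀, hinv, Finset.mem_singleton, Prod.mk.injEq] at hcr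
      exact hv (huniq2 _ _ hcr.2 hx)
  have hplanar : G.PlanarWithout x := planarWithout_iff.2 ⟨_, _, hins⟩
  -- Label `b` still has a representative after `i` is deleted, so an inversion of labels yields a
  -- crossing that avoids `i`.
  have hrep : ∀ (i : Fin _) (b : Fin 5), (b = f i → 2 ≤ weight m b) → ∃ u, f u = b ∧ u ≠ i := by
    intro i b hb
    by_cases hbi : b = f i
    · have h2 : 1 < (Finset.univ.filter fun i => f i = b).card := by
        rw [hcard]; exact hb hbi
      obtain ⟨u, hu, hui⟩ := Finset.exists_mem_ne h2 i
      exact ⟨u, by simpa using hu, hui⟩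
    · obtain ⟨u, rfl⟩ := hf b
      exact ⟨u, rfl, fun h => hbi (h ▸ rfl)⟩
  have huniq : ∀ i, G.PlanarWithout i → i = x := by
    intro i hi
    by_contra hix
    have hi2 : f i ≠ 2 := fun h => hix (huniq2 _ _ h hx)
    obtain ⟨X, Y, hXY⟩ := planarWithout_iff.1 hi
    obtain ⟨hXY, -, hcr⟩ := isInsertionLayout_iff.1 hXY
    obtain ⟨A, B, hA, hB, h⟩ := hG X Y hXY
    obtain ⟨⟨b, c⟩, hbc, hb, hc⟩ :=
      exists_inversion_avoiding A hA.mem_orders B hB.mem_orders (f i) hi2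
    obtain ⟨u, rfl, hu⟩ := hrep i b fun hbi => two_le_weight hm (hb hbi) (hbi ▸ hi2)
    obtain ⟨v, rfl, hv⟩ := hrep i c fun hci => two_le_weight hm (hc hci) (hci ▸ hi2)
    exact hcr u v hu hv ((h u v (hne hbc)).2 hbc)
  refine ⟨_, G, ⟨x, hplanar⟩, ?_, hcrt⟩
  rw [crtei_eq_of_unique hplanar huniq]
  apply le_antisymm
  · refine (crteiAt_le hins).trans ((hupper h₀).trans ?_)
    rw [hinv]
    simp [weight]
  · obtain ⟨X, Y, hXY, hc⟩ := exists_crossings_eq_crteiAt hplanar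
    obtain ⟨hXY, -, hcr⟩ := isInsertionLayout_iff.1 hXY
    obtain ⟨A, B, hA, hB, h⟩ := hG X Y hXY
    rw [← hc]
    refine le_trans ?_ (hlower h)
    obtain ⟨p, hp, hp'⟩ := exists_heavy_inversion A hA.mem_orders B hB.mem_orders (by
      rintro ⟨b, c⟩ hbc
      by_contra hn
      obtain ⟨hb, hc⟩ := not_or.1 hn
      obtain ⟨u, rfl⟩ := hf b
      obtain ⟨v, rfl⟩ := hf c
      exact hcr u v (fun hu => hb (hu ▸ hx)) (fun hv => hc (hv ▸ hx))
        ((h u v (hne hbc)).2 hbc))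
    refine le_trans ?_ (Finset.single_le_sum
      (f := fun p : Fin 5 × Fin 5 => weight m p.1 * weight m p.2)
      (fun _ _ => Nat.zero_le _) hp)
    have hw : ∀ b : Fin 5, b = 1 ∨ b = 3 → weight m b = m := by
      rintro b (rfl | rfl) <;> rfl
    rcases hp' with hp' | hp'
    · exact (hw _ hp').symm.le.trans (Nat.le_mul_of_pos_right _ (hpos _))
    · exact (hw _ hp').symm.le.trans (Nat.le_mul_of_pos_left _ (hpos _))

end Tanglegram

theorem mainTheorem7 (k : ℕ) :
    ∃ (n : ℕ) (G : Tanglegram (Fin n) (Fin n)),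
      (∃ i, G.PlanarWithout i) ∧ (G.crtei : ℤ) - (G.crt : ℤ) = (k : ℤ) := by
  obtain ⟨n, G, hG, h1, h2⟩ := Tanglegram.exists_tanglegram_crtei_eq (k + 4) (by omega)
  exact ⟨n, G, hG, by rw [h1, h2]; push_cast; ring⟩
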